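/- Let $\Lambda$ be a countable index set, $M\in\mathbb N$, $\mathcal H$ a real Hilbert space, $g\in\mathcal H$, and $T:\ell_2(\Lambda,\mathbb R^M)\to\mathcal H$ a bounded linear operator, where $\mathbb R^M$ carries the Euclidean norm. Let $1\le q\le\infty$ and let $(\theta_\lambda),(\rho_\lambda),(\omega_\lambda)$ be sequences of positive reals indexed by $\Lambda$. Let $\ell_{\infty,\rho^{-1}}(\Lambda)_+$ be the cone of real sequences $v=(v_\lambda)$ with $v_\lambda\ge 0$ for all $\lambda$ and $\sup_\lambda v_\lambda/\rho_\lambda<\infty$. For $u=(u_\lambda)\in\ell_2(\Lambda,\mathbb R^M)$ and $v\in\ell_{\infty,\rho^{-1}}(\Lambda)_+$ put $$J(u,v)=\|Tu-g\|_{\mathcal H}^2+\sum_{\lambda\in\Lambda}v_\lambda\|u_\lambda\|_q+\sum_{\lambda\in\Lambda}\omega_\lambda\|u_\lambda\|_2^2+\sum_{\lambda\in\Lambda}\theta_\lambda(\rho_\lambda-v_\lambda)^2\in[0,\infty].$$ Assume that $J$ is strictly convex (i.e. its effective domain $\{J<\infty\}$ is convex and $J$ is strictly convex on it), and that there is $\gamma>0$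 with $\omega_\lambda\ge\gamma$ for all $\lambda\in\Lambda$. Then $J$ has a unique minimizer $(u^*,v^*)$ in $\ell_2(\Lambda,\mathbb R^M)\times\ell_{\infty,\rho^{-1}}(\Lambda)_+$. Let $v^{(0)}\in\ell_{\infty,\rho^{-1}}(\Lambda)_+$ be such that $J(\cdot,v^{(0)})$ is not identically $\infty$ (for example $v^{(0)}=\rho$). Then the alternating minimization $$u^{(n)}=\arg\min_{u\in\ell_2(\Lambda,\mathbb R^M)}J(u,v^{(n-1)}),\qquad v^{(n)}=\arg\min_{v\in\ell_{\infty,\rho^{-1}}(\Lambda)_+}J(u^{(n)},v),\qquad n\ge1,$$ is well defined (each minimizer exists and is unique), and as $n\to\infty$, $u^{(n)}\to u^*$ weakly in $\ell_2(\Lambda,\mathbb R^M)$ and $v^{(n)}_\lambda\to v^*_\lambda$ for every $\lambda\in\Lambda$. Moreover, let $q\in\{1,2,\infty\}$ and put $\phi_1=M$, $\phi_2=1$, $\phi_\infty=\sqrt M$. If in addition there is $\sigma>\phi_q/4$ with $\theta_\lambda\omega_\lambda\ge\sigma$ for all $\lambda\in\Lambda$, then $u^{(n)}\to u^*$ strongly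 in $\ell_2(\Lambda,\mathbb R^M)$, and $v^{(n)}-v^*\to0$ in $\ell_{2,\theta}(\Lambda)$, i.e. $\sum_{\lambda\in\Lambda}\theta_\lambda^2|v^{(n)}_\lambda-v^*_\lambda|^2\to0$. -/

import Mathlib

open Filter Topology
open scoped ENNReal

namespace JointSparsity

noncomputable section

/-- The Hilbert space `ℓ₂(Λ, ℝ^M)` of square-summable families of vectors of `ℝ^M`, where `ℝ^M`
carries the Euclidean norm. -/
abbrev SeqSpace (Λ : Type*) (M : ℕ) : Type _ :=
  lp (fun _ : Λ => EuclideanSpace ℝ (Fin M)) 2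

/-- The `ℓ_q`-norm on `ℝ^M`, for `1 ≤ q ≤ ∞`. -/
def qNorm (q : ℝ≥0∞) {M : ℕ} (x : EuclideanSpace ℝ (Fin M)) : ℝ :=
  ‖(WithLp.toLp q (WithLp.ofLp x) : PiLp q (fun _ : Fin M => ℝ))‖

/-- The convex cone `ℓ_{∞,ρ⁻¹}(Λ)₊` of all nonnegative real sequences `v` such that
`v_λ / ρ_λ` is bounded. -/
def weightCone {Λ : Type*} (ρ : Λ → ℝ) : Set (Λ → ℝ) :=
  {v | (∀ i, 0 ≤ v i) ∧ Memℓp (fun i => (ρ i)⁻¹ * v i) ∞}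

/-- The joint sparsity measure
`Φ(u, v) = ∑ v_λ ‖u_λ‖_q + ∑ ω_λ ‖u_λ‖₂² + ∑ θ_λ (ρ_λ - v_λ)²`, with values in `[0, ∞]`,
for nonnegative sequences `v` and nonnegative weights. -/
def sparsityMeasure {Λ : Type*} {M : ℕ} (q : ℝ≥0∞) (θ ρ ω : Λ → ℝ)
    (u : SeqSpace Λ M) (v : Λ → ℝ) : ℝ≥0∞ :=
  (∑' i, ENNReal.ofReal (v i * qNorm q (u i)))
    + (∑' i, ENNReal.ofReal (ω i * ‖u i‖ ^ 2))
    + ∑' i, ENNReal.ofReal (θ i * (ρ i - v i) ^ 2)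

/-- The functional `J(u, v) = ‖T u - g‖² + Φ(u, v)`, with values in `[0, ∞]`. -/
def J {Λ : Type*} {M : ℕ} {H : Type*} [NormedAddCommGroup H] [InnerProductSpace ℝ H]
    (T : SeqSpace Λ M →L[ℝ] H) (g : H) (q : ℝ≥0∞) (θ ρ ω : Λ → ℝ)
    (u : SeqSpace Λ M) (v : Λ → ℝ) : ℝ≥0∞ :=
  ENNReal.ofReal (‖T u - g‖ ^ 2) + sparsityMeasure q θ ρ ω u v

/-- Strict convexity of the `[0, ∞]`-valued functional `J` on
`ℓ₂(Λ, ℝ^M) × ℓ_{∞,ρ⁻¹}(Λ)₊`: the effective domain (the set where `J` is finite) is convex and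
`J` is strictly convex there. -/
def StrictlyConvexJ {Λ : Type*} {M : ℕ} {H : Type*} [NormedAddCommGroup H]
    [InnerProductSpace ℝ H] (T : SeqSpace Λ M →L[ℝ] H) (g : H) (q : ℝ≥0∞)
    (θ ρ ω : Λ → ℝ) : Prop :=
  StrictConvexOn ℝ
    {p : SeqSpace Λ M × (Λ → ℝ) | p.2 ∈ weightCone ρ ∧ J T g q θ ρ ω p.1 p.2 ≠ ∞}
    (fun p => (J T g q θ ρ ω p.1 p.2).toReal)

/-- `x` is a minimizer of `f` over the set `s` (and lies in `s`). -/
def IsArgMin {X : Type*} (f : X → ℝ≥0∞) (s : Set X) (x : X) : Prop :=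
  x ∈ s ∧ IsMinOn f s x

/-- `(u, v)` is a minimizer of `J` over `ℓ₂(Λ, ℝ^M) × ℓ_{∞,ρ⁻¹}(Λ)₊`. -/
def IsJointMinimizer {Λ : Type*} {M : ℕ} {H : Type*} [NormedAddCommGroup H]
    [InnerProductSpace ℝ H] (T : SeqSpace Λ M →L[ℝ] H) (g : H) (q : ℝ≥0∞)
    (θ ρ ω : Λ → ℝ) (u : SeqSpace Λ M) (v : Λ → ℝ) : Prop :=
  IsArgMin (fun p : SeqSpace Λ M × (Λ → ℝ) => J T g q θ ρ ω p.1 p.2)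
    (Set.univ ×ˢ weightCone ρ) (u, v)

/-- The sequences `u⁽ⁿ⁾` (`n ≥ 1`; the entry `u 0` plays no role) and `v⁽ⁿ⁾` (`n ≥ 0`) are
produced by alternating minimization of `J` from the initial choice `v0`:
`u⁽ⁿ⁾` minimizes `J(·, v⁽ⁿ⁻¹⁾)` over `ℓ₂(Λ, ℝ^M)`, and `v⁽ⁿ⁾` minimizes `J(u⁽ⁿ⁾, ·)` over
`ℓ_{∞,ρ⁻¹}(Λ)₊`. -/
structure IsAlternatingMinimization {Λ : Type*} {M : ℕ} {H : Type*} [NormedAddCommGroup H]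
    [InnerProductSpace ℝ H] (T : SeqSpace Λ M →L[ℝ] H) (g : H) (q : ℝ≥0∞)
    (θ ρ ω : Λ → ℝ) (v0 : Λ → ℝ) (u : ℕ → SeqSpace Λ M) (v : ℕ → Λ → ℝ) : Prop where
  init : v 0 = v0
  u_step : ∀ n, IsArgMin (fun u' => J T g q θ ρ ω u' (v n)) Set.univ (u (n + 1))
  v_step : ∀ n, IsArgMin (fun v' => J T g q θ ρ ω (u (n + 1)) v') (weightCone ρ) (v (n + 1))

/-- Weak convergence in `ℓ₂(Λ, ℝ^M)`. -/
def WeaklyConverges {Λ : Type*} {M : ℕ} (u : ℕ → SeqSpace Λ M) (u' : SeqSpace Λ M) : Prop :=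
  ∀ f : SeqSpace Λ M →L[ℝ] ℝ, Tendsto (fun n => f (u n)) atTop (𝓝 (f u'))

/-- The norm `(∑ θ_λ² |w_λ|²)^{1/2}` of the weighted space `ℓ_{2,θ}(Λ)`, with value `∞` when `w`
is not in that space. -/
def weightedL2Norm {Λ : Type*} (θ w : Λ → ℝ) : ℝ≥0∞ :=
  (∑' i, ENNReal.ofReal ((θ i * |w i|) ^ 2)) ^ (1 / 2 : ℝ)

/-- The constants `φ₁ = M`, `φ₂ = 1`, `φ_∞ = √M` (used only for these three values of `q`). -/
def phi (q : ℝ≥0∞) (M : ℕ) : ℝ :=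
  if q = 1 then (M : ℝ) else if q = 2 then 1 else √(M : ℝ)

end

end JointSparsity

/-! For fixed `u` the best weight is explicit, coordinatewise `max (ρ - qNorm q u / (2θ)) 0`, so
everything reduces to `G u = J u (optWeight u)`. As a partial minimum of a convex functional, `G`
has convex sublevel sets; it is lower semicontinuous, and `ω ≥ γ` makes it coercive. In a Hilbert
space such a function attains its infimum, and if the minimizer is unique, minimizing sequences
converge weakly to it.

The iterates do minimize `G` in the limit. On a segment from `(u, v)` towards the minimizer, `u` and
`v` interact only through the coupling `v * qNorm q u`, whose mixed second difference is `O(t²)`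
(`J_add_J_le`). Hence `G (U (n+1)) ≤ (1 - t) G (U n) + t G us + 2 K t²`, where `K` is uniform in `n`
by `tsum_rho_mul_qNorm_le`. Letting `n → ∞`, dividing by `t` and letting `t → 0` gives the limit `G
us`.

If `θ ω ≥ σ > φ / 4`, the quadratic terms absorb the coupling with a margin, which makes `J`
uniformly convex in `u` (`J_midpoint_add_le`) and the convergence strong. The explicit weights
depend on `u` in a Lipschitz way and inherit it. -/

namespace JointSparsity

/-! ### Minimization and weak convergence in a Hilbert space -/

section HilbertSpace

variable {X : Type*} [NormedAddCommGroup X] [InnerProductSpace ℝ X] [CompleteSpace X]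

/-- The elements of least norm have increasing bounded norms, and the projection inequality turns
convergence of the norms into the Cauchy property. -/
theorem nonempty_iInter_of_antitone_convex {K : ℕ → Set X} (hanti : Antitone K)
    (hne : ∀ n, (K n).Nonempty) (hcl : ∀ n, IsClosed (K n)) (hcv : ∀ n, Convex ℝ (K n))
    {R : ℝ} (hR : ∀ x ∈ K 0, ‖x‖ ≤ R) : (⋂ n, K n).Nonempty := by
  have hex : ∀ n, ∃ v ∈ K n, ∀ w ∈ K n, ‖w - v‖ ^ 2 ≤ ‖w‖ ^ 2 - ‖v‖ ^ 2 := by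
    intro n
    obtain ⟨v, hv, hmin⟩ := exists_norm_eq_iInf_of_complete_convex (hne n)
      (hcl n).isComplete (hcv n) 0
    refine ⟨v, hv, fun w hw => ?_⟩
    have h := (norm_eq_iInf_iff_real_inner_le_zero (hcv n) hv).1 hmin w hw
    rw [zero_sub, inner_neg_left, inner_sub_right, real_inner_self_eq_norm_sq] at h
    have h2 := norm_sub_sq_real w v
    rw [real_inner_comm] at h2
    linarith
  choose x hxK hx using hex
  have hle : ∀ {n m}, n ≤ m → ‖x m - x n‖ ^ 2 ≤ ‖x m‖ ^ 2 - ‖x n‖ ^ 2 :=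
    fun {n m} h => hx n (x m) (hanti h (hxK m))
  have hmono : Monotone fun n => ‖x n‖ ^ 2 := fun n m h => by
    have := hle h
    have := sq_nonneg ‖x m - x n‖
    simp only
    linarith
  have hbdd : BddAbove (Set.range fun n => ‖x n‖ ^ 2) := by
    refine ⟨R ^ 2, ?_⟩
    rintro _ ⟨n, rfl⟩
    exact pow_le_pow_left₀ (norm_nonneg _) (hR _ (hanti (Nat.zero_le n) (hxK n))) 2
  have hlim := tendsto_atTop_ciSup hmono hbdd
  have hcauchy : CauchySeq x := by
    rw [Metric.cauchySeq_iff']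
    intro ε hε
    obtain ⟨N, hN⟩ := Metric.cauchySeq_iff'.1 hlim.cauchySeq (ε ^ 2) (by positivity)
    refine ⟨N, fun n hn => ?_⟩
    have h1 := (le_abs_self _).trans_lt (Real.dist_eq _ _ ▸ hN n hn)
    rw [dist_eq_norm]
    exact lt_of_pow_lt_pow_left₀ 2 hε.le ((hle hn).trans_lt h1)
  obtain ⟨y, hy⟩ := cauchySeq_tendsto_of_complete hcauchy
  refine ⟨y, Set.mem_iInter.2 fun n => (hcl n).mem_of_tendsto hy ?_⟩
  filter_upwards [eventually_ge_atTop n] with m hm using hanti hm (hxK m)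

/-- A coercive, lower semicontinuous function with convex sublevel sets attains the values which
it approaches on a closed convex set. -/
theorem exists_mem_le_of_forall_lt {F : X → ℝ≥0∞} (hF : LowerSemicontinuous F)
    (hconv : ∀ c, c ≠ ∞ → Convex ℝ {x | F x ≤ c}) {γ : ℝ} (hγ : 0 < γ)
    (hcoer : ∀ x, ENNReal.ofReal (γ * ‖x‖ ^ 2) ≤ F x) {C : Set X} (hC : IsClosed C)
    (hC' : Convex ℝ C) {m : ℝ≥0∞} (hm : m ≠ ∞) (hex : ∀ c, m < c → ∃ x ∈ C, F x ≤ c) :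
    ∃ x ∈ C, F x ≤ m := by
  -- Levels strictly above `m`, so that every sublevel set meets `C`, and decreasing to `m`.
  let e : ℕ → ℝ≥0∞ := fun n => m + ((n : ℝ≥0∞) + 1)⁻¹
  have he : ∀ n, e n ≠ ∞ := fun n => ENNReal.add_ne_top.2 ⟨hm, by simp⟩
  have hanti : Antitone fun n => C ∩ {x | F x ≤ e n} := fun a b hab x hx =>
    ⟨hx.1, (show F x ≤ e b from hx.2).trans <|
      add_le_add_right (ENNReal.inv_le_inv.2 <| add_le_add_left (Nat.cast_le.2 hab) 1) m⟩
  obtain ⟨x, hx⟩ := nonempty_iInter_of_antitone_convex hanti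
    (fun n => hex (e n) (ENNReal.lt_add_right hm (by simp)))
    (fun n => hC.inter (hF.isClosed_preimage (e n)))
    (fun n => hC'.inter (hconv _ (he n))) (R := √((e 0).toReal / γ)) (fun x hx => by
      refine Real.le_sqrt_of_sq_le ?_
      rw [le_div_iff₀ hγ, mul_comm]
      exact (ENNReal.ofReal_le_iff_le_toReal (he 0)).1 ((hcoer x).trans hx.2))
  rw [Set.mem_iInter] at hx
  refine ⟨x, (hx 0).1, ?_⟩
  have hlim : Tendsto e atTop (𝓝 (m + 0)) := by
    refine tendsto_const_nhds.add ?_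
    have := (tendsto_add_atTop_iff_nat 1).2 ENNReal.tendsto_inv_nat_nhds_zero
    simpa using this
  rw [add_zero] at hlim
  exact ge_of_tendsto' hlim fun n => (hx n).2

theorem exists_forall_le_of_coercive {F : X → ℝ≥0∞} (hF : LowerSemicontinuous F)
    (hconv : ∀ c, c ≠ ∞ → Convex ℝ {x | F x ≤ c}) {γ : ℝ} (hγ : 0 < γ)
    (hcoer : ∀ x, ENNReal.ofReal (γ * ‖x‖ ^ 2) ≤ F x) : ∃ x, ∀ y, F x ≤ F y := by
  by_cases hm : (⨅ y, F y) = ∞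
  · exact ⟨0, fun y => by rw [iInf_eq_top.1 hm y]; exact le_top⟩
  obtain ⟨x, -, hx⟩ := exists_mem_le_of_forall_lt hF hconv hγ hcoer isClosed_univ convex_univ hm
    fun c hc => by
      obtain ⟨x, hx⟩ := iInf_lt_iff.1 hc
      exact ⟨x, trivial, hx.le⟩
  exact ⟨x, fun y => hx.trans (iInf_le _ y)⟩

/-- Minimizing sequences converge weakly to the unique minimizer. -/
theorem tendsto_apply_of_tendsto_min {F : X → ℝ≥0∞} (hF : LowerSemicontinuous F)
    (hconv : ∀ c, c ≠ ∞ → Convex ℝ {x | F x ≤ c}) {γ : ℝ} (hγ : 0 < γ)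
    (hcoer : ∀ x, ENNReal.ofReal (γ * ‖x‖ ^ 2) ≤ F x) {y : X} (hy : F y ≠ ∞)
    (huniq : ∀ x, F x ≤ F y → x = y) {x : ℕ → X}
    (hx : Tendsto (fun n => F (x n)) atTop (𝓝 (F y))) (f : X →L[ℝ] ℝ) :
    Tendsto (fun n => f (x n)) atTop (𝓝 (f y)) := by
  have key : ∀ (f : X →L[ℝ] ℝ) (a : ℝ), a < f y → ∀ᶠ n in atTop, a < f (x n) := by
    intro f a ha
    -- Otherwise the closed half-space `f ≤ a` contains infinitely many terms of the minimizing
    -- sequence, hence a minimizer, which can only be `y`.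
    by_contra hcon
    have hfreq : ∃ᶠ n in atTop, f (x n) ≤ a := by
      simpa [Filter.Frequently] using hcon
    obtain ⟨z, hz, hzy⟩ := exists_mem_le_of_forall_lt hF hconv hγ hcoer
      (C := {z | f z ≤ a}) (isClosed_le f.continuous continuous_const)
      (convex_halfSpace_le f.isLinear a) hy fun c hc => by
        obtain ⟨n, hn, hn'⟩ := (hfreq.and_eventually (hx.eventually_lt_const hc)).exists
        exact ⟨x n, hn, hn'.le⟩
    rw [huniq z hzy] at hz
    exact absurd ha (not_lt.2 hz)
  refine tendsto_order.2 ⟨key f, fun a ha => ?_⟩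
  filter_upwards [key (-f) (-a) (by simpa using ha)] with n hn
  simpa using hn

end HilbertSpace
end JointSparsity

namespace JointSparsity

/-! ### The `ℓ_q`-norm on `ℝ^M` -/

section QNorm

variable {q : ℝ≥0∞} {M : ℕ}

theorem qNorm_nonneg (hq : 1 ≤ q) (x : EuclideanSpace ℝ (Fin M)) : 0 ≤ qNorm q x :=
  have := Fact.mk hq
  norm_nonneg _

theorem qNorm_zero (hq : 1 ≤ q) : qNorm q (0 : EuclideanSpace ℝ (Fin M)) = 0 := by
  have := Fact.mk hq
  simp [qNorm]

theorem qNorm_add_le (hq : 1 ≤ q) (x y : EuclideanSpace ℝ (Fin M)) :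
    qNorm q (x + y) ≤ qNorm q x + qNorm q y := by
  have := Fact.mk hq
  simpa only [qNorm, WithLp.ofLp_add, WithLp.toLp_add] using norm_add_le _ _

theorem qNorm_smul (hq : 1 ≤ q) {c : ℝ} (hc : 0 ≤ c) (x : EuclideanSpace ℝ (Fin M)) :
    qNorm q (c • x) = c * qNorm q x := by
  have := Fact.mk hq
  simp only [qNorm, WithLp.ofLp_smul, WithLp.toLp_smul, norm_smul, Real.norm_of_nonneg hc]

theorem qNorm_neg (hq : 1 ≤ q) (x : EuclideanSpace ℝ (Fin M)) : qNorm q (-x) = qNorm q x := by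
  have := Fact.mk hq
  simp only [qNorm, WithLp.ofLp_neg, WithLp.toLp_neg, norm_neg]

theorem abs_qNorm_sub_le (hq : 1 ≤ q) (x y : EuclideanSpace ℝ (Fin M)) :
    |qNorm q x - qNorm q y| ≤ qNorm q (x - y) := by
  have h1 := qNorm_add_le hq (x - y) y
  have h2 := qNorm_add_le hq (y - x) x
  rw [← neg_sub x y, qNorm_neg hq, neg_sub, sub_add_cancel] at h2
  rw [sub_add_cancel] at h1
  exact abs_le.2 ⟨by linarith, by linarith⟩

theorem continuous_qNorm (hq : 1 ≤ q) :
    Continuous (qNorm q : EuclideanSpace ℝ (Fin M) → ℝ) := by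
  have := Fact.mk hq
  exact continuous_norm.comp
    ((PiLp.continuous_toLp q _).comp (PiLp.continuous_ofLp 2 _))

theorem phi_nonneg (q : ℝ≥0∞) (M : ℕ) : 0 ≤ phi q M := by
  unfold phi
  split_ifs <;> positivity

theorem qNorm_sq_le (hq : q = 1 ∨ q = 2 ∨ q = ∞) (x : EuclideanSpace ℝ (Fin M)) :
    qNorm q x ^ 2 ≤ phi q M * ‖x‖ ^ 2 := by
  rcases hq with rfl | rfl | rfl
  · rw [qNorm, PiLp.norm_eq_of_L1, EuclideanSpace.norm_sq_eq, phi, if_pos rfl]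
    simpa using sq_sum_le_card_mul_sum_sq (s := Finset.univ) (f := fun i => ‖x i‖)
  · simp [qNorm, phi]
  -- For `q = ∞` the bound holds with constant `1`, which is at most `√M` unless `M = 0`.
  · rcases Nat.eq_zero_or_pos M with rfl | hM
    · have : x = 0 := Subsingleton.elim _ _
      simp [this, qNorm_zero]
    have h1 : qNorm ∞ x ≤ ‖x‖ := by
      have : Nonempty (Fin M) := ⟨⟨0, hM⟩⟩
      rw [qNorm, PiLp.norm_eq_ciSup]
      exact ciSup_le fun i => PiLp.norm_apply_le x i
    have h2 : (1 : ℝ) ≤ √M := Real.one_le_sqrt.2 (by exact_mod_cast hM)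
    have h3 : phi ∞ M = √M := by simp [phi]
    rw [h3]
    calc qNorm ∞ x ^ 2 ≤ 1 * ‖x‖ ^ 2 := by
          rw [one_mul]; exact pow_le_pow_left₀ (qNorm_nonneg le_top x) h1 2
      _ ≤ _ := by gcongr

end QNorm

/-! ### Inequalities for a single index -/

section Cost

/-- The contribution of one index to the joint sparsity measure. -/
noncomputable def cost {M : ℕ} (q : ℝ≥0∞) (θ ρ ω : ℝ) (x : EuclideanSpace ℝ (Fin M)) (y : ℝ) : ℝ :=
  y * qNorm q x + ω * ‖x‖ ^ 2 + θ * (ρ - y) ^ 2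

variable {q : ℝ≥0∞} {M : ℕ} {θ ρ ω : ℝ} {x x' : EuclideanSpace ℝ (Fin M)} {y y' : ℝ}

theorem cost_nonneg (hq : 1 ≤ q) (hθ : 0 < θ) (hω : 0 < ω) (hy : 0 ≤ y) :
    0 ≤ cost q θ ρ ω x y := by
  have := qNorm_nonneg hq x
  unfold cost
  positivity

theorem cost_max_le (hθ : 0 < θ) (hy : 0 ≤ y) :
    cost q θ ρ ω x (max (ρ - qNorm q x / (2 * θ)) 0) ≤ cost q θ ρ ω x y := by
  -- With `qNorm q x = 2θk` the cost is `θ (y - (ρ - k))²` plus a term free of `y`.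
  obtain ⟨k, hk⟩ : ∃ k, k = qNorm q x / (2 * θ) := ⟨_, rfl⟩
  have hN : qNorm q x = 2 * θ * k := by rw [hk]; field_simp
  rw [← hk]
  unfold cost
  rw [hN]
  rcases le_total 0 (ρ - k) with h | h
  · rw [max_eq_left h]
    nlinarith [mul_nonneg hθ.le (sq_nonneg (y - (ρ - k)))]
  · rw [max_eq_right h]
    nlinarith [mul_nonneg hθ.le (sq_nonneg y),
      mul_nonneg (mul_nonneg hθ.le hy) (sub_nonneg.2 (sub_nonpos.1 h))]

/-- All uncoupled terms cancel. What remains is `t (y - y')` times the change of `qNorm` along the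
segment, and that change is itself of order `t`. -/
theorem cost_add_cost_le (hq : 1 ≤ q) {t : ℝ} (ht0 : 0 ≤ t)
    (hy : 0 ≤ y) (hyρ : y ≤ ρ) (hy' : 0 ≤ y') (hyρ' : y' ≤ ρ) :
    cost q θ ρ ω ((1 - t) • x + t • x') y + cost q θ ρ ω x ((1 - t) * y + t * y') ≤
      cost q θ ρ ω ((1 - t) • x + t • x') ((1 - t) * y + t * y') + cost q θ ρ ω x y
        + t ^ 2 * (ρ * qNorm q x + ρ * qNorm q x') := by
  have hN := abs_qNorm_sub_le hq ((1 - t) • x + t • x') x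
  have hd : (1 - t) • x + t • x' - x = t • (x' - x) := by module
  rw [hd, qNorm_smul hq ht0] at hN
  have hd' : qNorm q (x' - x) ≤ qNorm q x' + qNorm q x := by
    have := qNorm_add_le hq x' (-x)
    rwa [qNorm_neg hq, ← sub_eq_add_neg] at this
  have he : |y - y'| ≤ ρ := abs_le.2 ⟨by linarith, by linarith⟩
  have hprod : (y - y') * (qNorm q ((1 - t) • x + t • x') - qNorm q x) ≤
      ρ * (t * (qNorm q x' + qNorm q x)) := by
    refine (le_abs_self _).trans ?_
    rw [abs_mul]
    exact mul_le_mul he (hN.trans (by gcongr)) (abs_nonneg _) ((abs_nonneg _).trans he)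
  unfold cost
  nlinarith [mul_le_mul_of_nonneg_left hprod ht0]

/-- The quadratic terms gain `(ω ‖x - x'‖² + θ (y - y')²) / 4` at the midpoint, while the coupling
loses at most `|y - y'| |qNorm q x - qNorm q x'| / 4`. By AM-GM and `hφ`, the condition `hε` lets
the gain cover this loss and keep a fraction `ε` of the `ω` part. -/
theorem cost_midpoint_le (hq : 1 ≤ q) (hθ : 0 < θ) (hy : 0 ≤ y) (hy' : 0 ≤ y') {φ ε : ℝ}
    (hφ : qNorm q (x - x') ^ 2 ≤ φ * ‖x - x'‖ ^ 2) (hε : φ / 4 ≤ (1 - ε) * (θ * ω)) :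
    cost q θ ρ ω ((2⁻¹ : ℝ) • x + (2⁻¹ : ℝ) • x') (2⁻¹ * y + 2⁻¹ * y')
        + ε * ω / 4 * ‖x - x'‖ ^ 2 ≤
      2⁻¹ * cost q θ ρ ω x y + 2⁻¹ * cost q θ ρ ω x' y' := by
  have hpar := parallelogram_law_with_norm ℝ x x'
  have hmid : ‖(2⁻¹ : ℝ) • x + (2⁻¹ : ℝ) • x'‖ ^ 2 = ‖x + x'‖ ^ 2 / 4 := by
    rw [← smul_add, norm_smul, mul_pow]; norm_num; ring
  have hN : qNorm q ((2⁻¹ : ℝ) • x + (2⁻¹ : ℝ) • x') ≤ 2⁻¹ * qNorm q x + 2⁻¹ * qNorm q x' := by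
    refine (qNorm_add_le hq _ _).trans_eq ?_
    rw [qNorm_smul hq (by norm_num), qNorm_smul hq (by norm_num)]
  have hsub := abs_qNorm_sub_le hq x x'
  set n := qNorm q (x - x')
  set d := ‖x - x'‖ ^ 2
  have hn : (qNorm q x - qNorm q x') ^ 2 ≤ n ^ 2 := sq_le_sq' (abs_le.1 hsub).1 (abs_le.1 hsub).2
  have hamgm : -((y - y') * (qNorm q x - qNorm q x')) ≤
      θ * (y - y') ^ 2 + (1 - ε) * ω * d := by
    have h1 : θ * (-((y - y') * (qNorm q x - qNorm q x'))) ≤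
        θ * (θ * (y - y') ^ 2 + (1 - ε) * ω * d) := by
      have h2 : φ / 4 * d ≤ (1 - ε) * (θ * ω) * d :=
        mul_le_mul_of_nonneg_right hε (sq_nonneg _)
      nlinarith [sq_nonneg (θ * (y - y') + (qNorm q x - qNorm q x') / 2)]
    exact le_of_mul_le_mul_left h1 hθ
  have hm := mul_le_mul_of_nonneg_left hN (show 0 ≤ 2⁻¹ * y + 2⁻¹ * y' by positivity)
  have hs : ‖x + x'‖ ^ 2 = 2 * (‖x‖ ^ 2 + ‖x'‖ ^ 2) - d := by simp only [d]; nlinarith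
  unfold cost
  rw [hmid, hs]
  nlinarith

end Cost
end JointSparsity

namespace JointSparsity

/-! ### The functional `J` and its optimal weights -/

section Functional

variable {Λ : Type*} {M : ℕ} {H : Type*} [NormedAddCommGroup H] [InnerProductSpace ℝ H]
  {T : SeqSpace Λ M →L[ℝ] H} {g : H} {q : ℝ≥0∞} {θ ρ ω : Λ → ℝ}

theorem J_eq_tsum_cost (hq : 1 ≤ q) (hθ : ∀ i, 0 < θ i) (hω : ∀ i, 0 < ω i) (u : SeqSpace Λ M)
    {v : Λ → ℝ} (hv : ∀ i, 0 ≤ v i) :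
    J T g q θ ρ ω u v =
      ENNReal.ofReal (‖T u - g‖ ^ 2) + ∑' i, ENNReal.ofReal (cost q (θ i) (ρ i) (ω i) (u i) (v i)) := by
  rw [J, sparsityMeasure, ← ENNReal.tsum_add, ← ENNReal.tsum_add]
  congr 1
  refine tsum_congr fun i => ?_
  have h1 : 0 ≤ v i * qNorm q (u i) := mul_nonneg (hv i) (qNorm_nonneg hq _)
  have h2 : 0 ≤ ω i * ‖u i‖ ^ 2 := mul_nonneg (hω i).le (sq_nonneg _)
  have h3 : 0 ≤ θ i * (ρ i - v i) ^ 2 := mul_nonneg (hθ i).le (sq_nonneg _)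
  rw [← ENNReal.ofReal_add h1 h2, ← ENNReal.ofReal_add (add_nonneg h1 h2) h3, cost]

theorem ofReal_mul_norm_sq_eq_tsum {γ : ℝ} (hγ : 0 ≤ γ) (u : SeqSpace Λ M) :
    ENNReal.ofReal (γ * ‖u‖ ^ 2) = ∑' i, ENNReal.ofReal (γ * ‖u i‖ ^ 2) := by
  have h := lp.hasSum_norm (p := 2) (by norm_num) u
  have h' : HasSum (fun i => γ * ‖u i‖ ^ 2) (γ * ‖u‖ ^ 2) := by
    simpa using h.mul_left γ
  rw [← h'.tsum_eq, ENNReal.ofReal_tsum_of_nonneg (fun i => by positivity) h'.summable]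

theorem ofReal_mul_norm_sq_le_J {γ : ℝ} (hγ : 0 < γ) (hω : ∀ i, γ ≤ ω i) (u : SeqSpace Λ M)
    (v : Λ → ℝ) : ENNReal.ofReal (γ * ‖u‖ ^ 2) ≤ J T g q θ ρ ω u v := by
  rw [ofReal_mul_norm_sq_eq_tsum hγ.le, J, sparsityMeasure]
  refine le_trans ?_ (le_add_left (le_add_right (le_add_left le_rfl)))
  refine ENNReal.tsum_le_tsum fun i => ENNReal.ofReal_le_ofReal ?_
  have := hω i
  gcongr

theorem tsum_mul_qNorm_le_J (u : SeqSpace Λ M) (v : Λ → ℝ) :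
    ∑' i, ENNReal.ofReal (v i * qNorm q (u i)) ≤ J T g q θ ρ ω u v := by
  rw [J, sparsityMeasure]
  exact le_add_left (le_add_right (le_add_right le_rfl))

theorem J_zero_rho (hq : 1 ≤ q) : J T g q θ ρ ω 0 ρ = ENNReal.ofReal (‖g‖ ^ 2) := by
  simp [J, sparsityMeasure, qNorm_zero hq]

theorem continuous_eval (i : Λ) : Continuous fun u : SeqSpace Λ M => u i :=
  (lp.evalCLM ℝ (fun _ : Λ => EuclideanSpace ℝ (Fin M)) 2 i).continuous

/-- Each summand is continuous in `u`, and sums of nonnegative lower semicontinuous functions are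
lower semicontinuous. The weights may vary with `u`, to cover both a fixed `v` and `optWeight`. -/
theorem lowerSemicontinuous_J (hq : 1 ≤ q) {V : SeqSpace Λ M → Λ → ℝ}
    (hV : ∀ i, Continuous fun u => V u i) :
    LowerSemicontinuous fun u => J T g q θ ρ ω u (V u) := by
  have hN : ∀ i, Continuous fun u : SeqSpace Λ M => qNorm q (u i) :=
    fun i => (continuous_qNorm hq).comp (continuous_eval i)
  have hc : ∀ i, Continuous fun u : SeqSpace Λ M => u i := continuous_eval
  unfold J sparsityMeasure
  refine LowerSemicontinuous.add (Continuous.lowerSemicontinuous ?_) ((LowerSemicontinuous.add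
    (lowerSemicontinuous_tsum fun i => Continuous.lowerSemicontinuous ?_)
    (lowerSemicontinuous_tsum fun i => Continuous.lowerSemicontinuous ?_)).add
    (lowerSemicontinuous_tsum fun i => Continuous.lowerSemicontinuous ?_))
  · exact ENNReal.continuous_ofReal.comp (by fun_prop)
  · exact ENNReal.continuous_ofReal.comp ((hV i).mul (hN i))
  · exact ENNReal.continuous_ofReal.comp (continuous_const.mul ((hc i).norm.pow 2))
  · exact ENNReal.continuous_ofReal.comp
      (continuous_const.mul ((continuous_const.sub (hV i)).pow 2))

theorem rho_mem_weightCone (hρ : ∀ i, 0 < ρ i) : ρ ∈ weightCone ρ := by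
  refine ⟨fun i => (hρ i).le, memℓp_infty ⟨1, ?_⟩⟩
  rintro _ ⟨i, rfl⟩
  simp [(hρ i).ne']

theorem mem_weightCone_of_le (hρ : ∀ i, 0 < ρ i) {v : Λ → ℝ} (h0 : ∀ i, 0 ≤ v i)
    (h : ∀ i, v i ≤ ρ i) : v ∈ weightCone ρ := by
  refine ⟨h0, memℓp_infty ⟨1, ?_⟩⟩
  rintro _ ⟨i, rfl⟩
  have h1 := mul_le_mul_of_nonneg_left (h i) (inv_nonneg.2 (hρ i).le)
  rw [inv_mul_cancel₀ (hρ i).ne'] at h1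
  beta_reduce
  rwa [Real.norm_of_nonneg (mul_nonneg (inv_nonneg.2 (hρ i).le) (h0 i))]

/-- The weights minimizing `J u` over the weight cone. -/
noncomputable def optWeight (q : ℝ≥0∞) (θ ρ : Λ → ℝ) (u : SeqSpace Λ M) (i : Λ) : ℝ :=
  max (ρ i - qNorm q (u i) / (2 * θ i)) 0

theorem optWeight_nonneg (u : SeqSpace Λ M) (i : Λ) : 0 ≤ optWeight q θ ρ u i := le_max_right _ _

theorem optWeight_le (hq : 1 ≤ q) (hθ : ∀ i, 0 < θ i) (hρ : ∀ i, 0 < ρ i) (u : SeqSpace Λ M)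
    (i : Λ) : optWeight q θ ρ u i ≤ ρ i :=
  max_le (sub_le_self _ (div_nonneg (qNorm_nonneg hq _) (by linarith [hθ i]))) (hρ i).le

theorem optWeight_mem (hq : 1 ≤ q) (hθ : ∀ i, 0 < θ i) (hρ : ∀ i, 0 < ρ i) (u : SeqSpace Λ M) :
    optWeight q θ ρ u ∈ weightCone ρ :=
  mem_weightCone_of_le hρ (optWeight_nonneg u) (optWeight_le hq hθ hρ u)

theorem continuous_optWeight_of (hq : 1 ≤ q) (i : Λ) :
    Continuous fun x : EuclideanSpace ℝ (Fin M) => max (ρ i - qNorm q x / (2 * θ i)) 0 :=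
  (continuous_const.sub ((continuous_qNorm hq).div_const _)).max continuous_const

/-- Truncation at `0` is 1-Lipschitz. The factor `θ i` cancels the slope `1 / (2θ)`, which is why
the weights converge in `ℓ_{2,θ}`. -/
theorem mul_abs_optWeight_sub_le (hq : 1 ≤ q) (hθ : ∀ i, 0 < θ i) (u u' : SeqSpace Λ M) (i : Λ) :
    θ i * |optWeight q θ ρ u i - optWeight q θ ρ u' i| ≤ qNorm q (u i - u' i) / 2 := by
  have h1 : |optWeight q θ ρ u i - optWeight q θ ρ u' i| ≤ qNorm q (u i - u' i) / (2 * θ i) := by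
    refine (abs_max_sub_max_le_abs _ _ _).trans ?_
    rw [sub_sub_sub_cancel_left, ← sub_div, abs_div, abs_of_pos (by linarith [hθ i] : 0 < 2 * θ i),
      abs_sub_comm]
    have := hθ i
    exact div_le_div_of_nonneg_right (abs_qNorm_sub_le hq _ _) (by positivity)
  calc _ ≤ θ i * (qNorm q (u i - u' i) / (2 * θ i)) := mul_le_mul_of_nonneg_left h1 (hθ i).le
    _ = _ := by have := (hθ i).ne'; field_simp

theorem J_optWeight_le (hq : 1 ≤ q) (hθ : ∀ i, 0 < θ i) (hω : ∀ i, 0 < ω i)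
    (u : SeqSpace Λ M) {v : Λ → ℝ} (hv : ∀ i, 0 ≤ v i) :
    J T g q θ ρ ω u (optWeight q θ ρ u) ≤ J T g q θ ρ ω u v := by
  rw [J_eq_tsum_cost hq hθ hω u (optWeight_nonneg u), J_eq_tsum_cost hq hθ hω u hv]
  gcongr with i
  exact cost_max_le (hθ i) (hv i)

theorem isArgMin_optWeight (hq : 1 ≤ q) (hθ : ∀ i, 0 < θ i) (hρ : ∀ i, 0 < ρ i)
    (hω : ∀ i, 0 < ω i) (u : SeqSpace Λ M) :
    IsArgMin (fun v => J T g q θ ρ ω u v) (weightCone ρ) (optWeight q θ ρ u) :=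
  ⟨optWeight_mem hq hθ hρ u, fun _ hv => J_optWeight_le hq hθ hω u hv.1⟩

/-- The fit term occurs at the same two points on both sides. The additive form avoids subtraction
in `ℝ≥0∞`. -/
theorem J_add_J_le (hq : 1 ≤ q) (hθ : ∀ i, 0 < θ i) (hω : ∀ i, 0 < ω i) (u u' : SeqSpace Λ M)
    {v v' : Λ → ℝ} (hv : ∀ i, 0 ≤ v i) (hvρ : ∀ i, v i ≤ ρ i) (hv' : ∀ i, 0 ≤ v' i)
    (hvρ' : ∀ i, v' i ≤ ρ i) {t : ℝ} (ht0 : 0 ≤ t) (ht1 : t ≤ 1) :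
    J T g q θ ρ ω ((1 - t) • u + t • u') v + J T g q θ ρ ω u ((1 - t) • v + t • v') ≤
      J T g q θ ρ ω ((1 - t) • u + t • u') ((1 - t) • v + t • v') + J T g q θ ρ ω u v +
        ENNReal.ofReal (t ^ 2) * (∑' i, ENNReal.ofReal (ρ i * qNorm q (u i)) +
          ∑' i, ENNReal.ofReal (ρ i * qNorm q (u' i))) := by
  have hρ : ∀ i, 0 ≤ ρ i := fun i => (hv i).trans (hvρ i)
  have hw : ∀ i, 0 ≤ ((1 - t) • v + t • v') i := fun i =>
    add_nonneg (mul_nonneg (sub_nonneg.2 ht1) (hv i)) (mul_nonneg ht0 (hv' i))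
  rw [J_eq_tsum_cost hq hθ hω _ hv, J_eq_tsum_cost hq hθ hω _ hw, J_eq_tsum_cost hq hθ hω _ hw,
    J_eq_tsum_cost hq hθ hω _ hv, ← ENNReal.tsum_add, ← ENNReal.tsum_mul_left]
  refine (add_add_add_comm _ _ _ _).trans_le (le_of_le_of_eq (add_le_add_right ?_ _)
    ((add_assoc _ _ _).symm.trans (congrArg (· + _) (add_add_add_comm _ _ _ _))))
  rw [← ENNReal.tsum_add, ← ENNReal.tsum_add, ← ENNReal.tsum_add]
  refine ENNReal.tsum_le_tsum fun i => ?_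
  have hn : ∀ x : EuclideanSpace ℝ (Fin M), 0 ≤ ρ i * qNorm q x :=
    fun x => mul_nonneg (hρ i) (qNorm_nonneg hq x)
  have hc : ∀ (x : EuclideanSpace ℝ (Fin M)) {y : ℝ}, 0 ≤ y →
      0 ≤ cost q (θ i) (ρ i) (ω i) x y := fun x y => cost_nonneg hq (hθ i) (hω i)
  rw [← ENNReal.ofReal_add (hn _) (hn _), ← ENNReal.ofReal_mul (sq_nonneg t),
    ← ENNReal.ofReal_add (hc _ (hv i)) (hc _ (hw i)),
    ← ENNReal.ofReal_add (hc _ (hw i)) (hc _ (hv i)),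
    ← ENNReal.ofReal_add (add_nonneg (hc _ (hw i)) (hc _ (hv i)))
      (mul_nonneg (sq_nonneg t) (add_nonneg (hn _) (hn _)))]
  exact ENNReal.ofReal_le_ofReal
    (cost_add_cost_le hq ht0 (hv i) (hvρ i) (hv' i) (hvρ' i))

theorem J_midpoint_add_le (hq : 1 ≤ q) (hθ : ∀ i, 0 < θ i) {γ : ℝ} (hγ : 0 < γ)
    (hω : ∀ i, γ ≤ ω i) {φ ε : ℝ} (hφ : ∀ x : EuclideanSpace ℝ (Fin M), qNorm q x ^ 2 ≤ φ * ‖x‖ ^ 2)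
    (hε0 : 0 ≤ ε) (hε : ∀ i, φ / 4 ≤ (1 - ε) * (θ i * ω i)) (u u' : SeqSpace Λ M)
    {v v' : Λ → ℝ} (hv : ∀ i, 0 ≤ v i) (hv' : ∀ i, 0 ≤ v' i) :
    J T g q θ ρ ω ((2⁻¹ : ℝ) • u + (2⁻¹ : ℝ) • u') ((2⁻¹ : ℝ) • v + (2⁻¹ : ℝ) • v') +
        ENNReal.ofReal (ε * γ / 4 * ‖u - u'‖ ^ 2) ≤
      ENNReal.ofReal 2⁻¹ * J T g q θ ρ ω u v + ENNReal.ofReal 2⁻¹ * J T g q θ ρ ω u' v' := by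
  have hω0 : ∀ i, 0 < ω i := fun i => hγ.trans_le (hω i)
  have hw : ∀ i, 0 ≤ ((2⁻¹ : ℝ) • v + (2⁻¹ : ℝ) • v') i := fun i =>
    add_nonneg (mul_nonneg (by norm_num) (hv i)) (mul_nonneg (by norm_num) (hv' i))
  rw [J_eq_tsum_cost hq hθ hω0 _ hv, J_eq_tsum_cost hq hθ hω0 _ hw, J_eq_tsum_cost hq hθ hω0 _ hv',
    ofReal_mul_norm_sq_eq_tsum (by positivity), mul_add, mul_add, add_add_add_comm, add_assoc,
    ← ENNReal.tsum_add, ← ENNReal.tsum_mul_left, ← ENNReal.tsum_mul_left, ← ENNReal.tsum_add]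
  refine add_le_add ?_ (ENNReal.tsum_le_tsum fun i => ?_)
  · rw [← ENNReal.ofReal_mul (by norm_num), ← ENNReal.ofReal_mul (by norm_num),
      ← ENNReal.ofReal_add (by positivity) (by positivity)]
    refine ENNReal.ofReal_le_ofReal ?_
    have h : T ((2⁻¹ : ℝ) • u + (2⁻¹ : ℝ) • u') - g =
        (2⁻¹ : ℝ) • ((T u - g) + (T u' - g)) := by
      rw [map_add, map_smul, map_smul]; module
    have hpar := parallelogram_law_with_norm ℝ (T u - g) (T u' - g)
    rw [h, norm_smul, Real.norm_of_nonneg (by norm_num)]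
    nlinarith [sq_nonneg ‖(T u - g) - (T u' - g)‖]
  · have hc : ∀ (x : EuclideanSpace ℝ (Fin M)) {y : ℝ}, 0 ≤ y →
        0 ≤ cost q (θ i) (ρ i) (ω i) x y := fun x y => cost_nonneg hq (hθ i) (hω0 i)
    have h1 := hc (u i) (hv i)
    have h2 := hc (u' i) (hv' i)
    rw [← ENNReal.ofReal_mul (by norm_num), ← ENNReal.ofReal_mul (by norm_num),
      ← ENNReal.ofReal_add (hc _ (hw i)) (by positivity),
      ← ENNReal.ofReal_add (by positivity) (by positivity)]
    refine ENNReal.ofReal_le_ofReal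
      (le_trans ?_ (cost_midpoint_le hq (hθ i) (hv i) (hv' i) (hφ _) (hε i)))
    have := hω i
    refine add_le_add le_rfl ?_
    change ε * γ / 4 * ‖u i - u' i‖ ^ 2 ≤ _
    gcongr

end Functional
end JointSparsity

namespace JointSparsity

/-! ### Consequences of strict convexity: uniqueness, existence, convergence -/

section StrictlyConvex

variable {Λ : Type*} {M : ℕ} {H : Type*} [NormedAddCommGroup H] [InnerProductSpace ℝ H]
  {T : SeqSpace Λ M →L[ℝ] H} {g : H} {q : ℝ≥0∞} {θ ρ ω : Λ → ℝ}

theorem StrictlyConvexJ.le_combo (hJ : StrictlyConvexJ T g q θ ρ ω) {u u' : SeqSpace Λ M}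
    {v v' : Λ → ℝ} (hv : v ∈ weightCone ρ) (hv' : v' ∈ weightCone ρ)
    (h : J T g q θ ρ ω u v ≠ ∞) (h' : J T g q θ ρ ω u' v' ≠ ∞) {a b : ℝ} (ha : 0 ≤ a) (hb : 0 ≤ b)
    (hab : a + b = 1) :
    J T g q θ ρ ω (a • u + b • u') (a • v + b • v') ≤
      ENNReal.ofReal a * J T g q θ ρ ω u v + ENNReal.ofReal b * J T g q θ ρ ω u' v' := by
  have h1 := (hJ.1 (x := (u, v)) ⟨hv, h⟩ (y := (u', v')) ⟨hv', h'⟩ ha hb hab).2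
  have h2 := hJ.convexOn.2 (x := (u, v)) ⟨hv, h⟩ (y := (u', v')) ⟨hv', h'⟩ ha hb hab
  simp only [Prod.smul_mk, Prod.mk_add_mk, smul_eq_mul] at h1 h2
  rw [← ENNReal.ofReal_toReal h1]
  refine (ENNReal.ofReal_le_ofReal h2).trans_eq ?_
  rw [ENNReal.ofReal_add (by positivity) (by positivity), ENNReal.ofReal_mul ha,
    ENNReal.ofReal_mul hb, ENNReal.ofReal_toReal h, ENNReal.ofReal_toReal h']

theorem StrictlyConvexJ.eq_of_forall_le (hJ : StrictlyConvexJ T g q θ ρ ω)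
    {S : Set (SeqSpace Λ M × (Λ → ℝ))} (hS : Convex ℝ S) (hSρ : ∀ p ∈ S, p.2 ∈ weightCone ρ)
    {p p' : SeqSpace Λ M × (Λ → ℝ)} (hp : p ∈ S) (hp' : p' ∈ S)
    (hfin : J T g q θ ρ ω p.1 p.2 ≠ ∞)
    (hmin : ∀ x ∈ S, J T g q θ ρ ω p.1 p.2 ≤ J T g q θ ρ ω x.1 x.2)
    (hmin' : ∀ x ∈ S, J T g q θ ρ ω p'.1 p'.2 ≤ J T g q θ ρ ω x.1 x.2) : p = p' := by
  have hfin' : J T g q θ ρ ω p'.1 p'.2 ≠ ∞ := ne_top_of_le_ne_top hfin (hmin' p hp)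
  have hsub : S ∩ {p | p.2 ∈ weightCone ρ ∧ J T g q θ ρ ω p.1 p.2 ≠ ∞} ⊆
      {p | p.2 ∈ weightCone ρ ∧ J T g q θ ρ ω p.1 p.2 ≠ ∞} := Set.inter_subset_right
  refine StrictConvexOn.eq_of_isMinOn (StrictConvexOn.subset hJ hsub (hS.inter hJ.1))
    (fun x hx => ?_) (fun x hx => ?_) ⟨hp, hSρ p hp, hfin⟩ ⟨hp', hSρ p' hp', hfin'⟩
  · exact ENNReal.toReal_mono hx.2.2 (hmin x hx.1)
  · exact ENNReal.toReal_mono hx.2.2 (hmin' x hx.1)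

theorem convex_weightCone : Convex ℝ (weightCone ρ) := by
  intro v hv w hw a b ha hb _
  refine ⟨fun i => add_nonneg (mul_nonneg ha (hv.1 i)) (mul_nonneg hb (hw.1 i)), ?_⟩
  have := (hv.2.const_smul a).add (hw.2.const_smul b)
  convert this using 1
  ext i
  simp only [Pi.add_apply, Pi.smul_apply, smul_eq_mul]
  ring

theorem StrictlyConvexJ.eq_of_isJointMinimizer (hJ : StrictlyConvexJ T g q θ ρ ω) (hq : 1 ≤ q)
    (hρ : ∀ i, 0 < ρ i) {u u' : SeqSpace Λ M} {v v' : Λ → ℝ}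
    (h : IsJointMinimizer T g q θ ρ ω u v) (h' : IsJointMinimizer T g q θ ρ ω u' v') :
    u = u' ∧ v = v' := by
  have hfin : J T g q θ ρ ω u v ≠ ∞ := by
    have := isMinOn_iff.1 h.2 (0, ρ) ⟨trivial, rho_mem_weightCone hρ⟩
    simp only [J_zero_rho hq] at this
    exact ne_top_of_le_ne_top ENNReal.ofReal_ne_top this
  exact Prod.mk_inj.1 (hJ.eq_of_forall_le (convex_univ.prod convex_weightCone) (fun p hp => hp.2) h.1 h'.1 hfin
    (fun x hx => h.2 hx) (fun x hx => h'.2 hx))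

theorem StrictlyConvexJ.eq_of_isArgMin_left (hJ : StrictlyConvexJ T g q θ ρ ω)
    {u u' : SeqSpace Λ M} {v : Λ → ℝ} (hv : v ∈ weightCone ρ) (hfin : J T g q θ ρ ω u v ≠ ∞)
    (h : IsArgMin (fun w => J T g q θ ρ ω w v) Set.univ u)
    (h' : IsArgMin (fun w => J T g q θ ρ ω w v) Set.univ u') : u = u' := by
  refine (Prod.mk_inj.1 (hJ.eq_of_forall_le (convex_univ.prod (convex_singleton v)) ?_
    (p := (u, v)) (p' := (u', v)) ⟨trivial, rfl⟩ ⟨trivial, rfl⟩ hfin ?_ ?_)).1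
  · rintro ⟨x, y⟩ ⟨-, rfl⟩; exact hv
  · rintro ⟨x, y⟩ ⟨-, rfl⟩; exact h.2 (Set.mem_univ x)
  · rintro ⟨x, y⟩ ⟨-, rfl⟩; exact h'.2 (Set.mem_univ x)

theorem StrictlyConvexJ.eq_of_isArgMin_right (hJ : StrictlyConvexJ T g q θ ρ ω)
    {u : SeqSpace Λ M} {v v' : Λ → ℝ} (hfin : J T g q θ ρ ω u v ≠ ∞)
    (h : IsArgMin (fun w => J T g q θ ρ ω u w) (weightCone ρ) v)
    (h' : IsArgMin (fun w => J T g q θ ρ ω u w) (weightCone ρ) v') : v = v' := by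
  refine (Prod.mk_inj.1 (hJ.eq_of_forall_le ((convex_singleton u).prod convex_weightCone) ?_
    (p := (u, v)) (p' := (u, v')) ⟨rfl, h.1⟩ ⟨rfl, h'.1⟩ hfin ?_ ?_)).2
  · rintro ⟨x, y⟩ ⟨-, hy⟩; exact hy
  · rintro ⟨x, y⟩ ⟨rfl, hy⟩; exact h.2 hy
  · rintro ⟨x, y⟩ ⟨rfl, hy⟩; exact h'.2 hy

/-- The hypothesis `hle` says that `V` does at least as well as the averaged weights: an equality
for constant `V`, optimality for `optWeight`. -/
theorem StrictlyConvexJ.convex_sublevel (hJ : StrictlyConvexJ T g q θ ρ ω)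
    {V : SeqSpace Λ M → Λ → ℝ} (hV : ∀ u, V u ∈ weightCone ρ)
    (hle : ∀ (u u' : SeqSpace Λ M) (a b : ℝ), 0 ≤ a → 0 ≤ b → a + b = 1 →
      J T g q θ ρ ω (a • u + b • u') (V (a • u + b • u')) ≤
        J T g q θ ρ ω (a • u + b • u') (a • V u + b • V u')) {c : ℝ≥0∞} (hc : c ≠ ∞) :
    Convex ℝ {u | J T g q θ ρ ω u (V u) ≤ c} := by
  intro u hu u' hu' a b ha hb hab
  refine (hle u u' a b ha hb hab).trans ((hJ.le_combo (hV u) (hV u')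
    (ne_top_of_le_ne_top hc hu) (ne_top_of_le_ne_top hc hu') ha hb hab).trans ?_)
  calc _ ≤ ENNReal.ofReal a * c + ENNReal.ofReal b * c :=
        add_le_add (mul_le_mul_right hu _) (mul_le_mul_right hu' _)
    _ = c := by rw [← add_mul, ← ENNReal.ofReal_add ha hb, hab, ENNReal.ofReal_one, one_mul]

theorem StrictlyConvexJ.convex_sublevel_left (hJ : StrictlyConvexJ T g q θ ρ ω) {v : Λ → ℝ}
    (hv : v ∈ weightCone ρ) {c : ℝ≥0∞} (hc : c ≠ ∞) :
    Convex ℝ {u | J T g q θ ρ ω u v ≤ c} :=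
  hJ.convex_sublevel (V := fun _ => v) (fun _ => hv)
    (fun _ _ _ _ _ _ hab => by rw [Convex.combo_self hab]) hc

theorem StrictlyConvexJ.convex_sublevel_optWeight (hJ : StrictlyConvexJ T g q θ ρ ω)
    (hq : 1 ≤ q) (hθ : ∀ i, 0 < θ i) (hρ : ∀ i, 0 < ρ i) (hω : ∀ i, 0 < ω i) {c : ℝ≥0∞}
    (hc : c ≠ ∞) : Convex ℝ {u | J T g q θ ρ ω u (optWeight q θ ρ u) ≤ c} :=
  hJ.convex_sublevel (optWeight_mem hq hθ hρ)
    (fun u u' _ _ ha hb hab => J_optWeight_le hq hθ hω _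
      (convex_weightCone (optWeight_mem hq hθ hρ u) (optWeight_mem hq hθ hρ u') ha hb hab).1) hc

theorem lowerSemicontinuous_J_optWeight (hq : 1 ≤ q) :
    LowerSemicontinuous fun u => J T g q θ ρ ω u (optWeight q θ ρ u) :=
  lowerSemicontinuous_J hq fun i => (continuous_optWeight_of hq i).comp (continuous_eval i)

theorem StrictlyConvexJ.exists_isArgMin_left (hJ : StrictlyConvexJ T g q θ ρ ω) (hq : 1 ≤ q)
    {γ : ℝ} (hγ : 0 < γ) (hω : ∀ i, γ ≤ ω i) {v : Λ → ℝ} (hv : v ∈ weightCone ρ) :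
    ∃ u, IsArgMin (fun w => J T g q θ ρ ω w v) Set.univ u := by
  obtain ⟨u, hu⟩ := exists_forall_le_of_coercive
    (lowerSemicontinuous_J hq (V := fun _ => v) fun _ => continuous_const)
    (fun c hc => hJ.convex_sublevel_left hv hc) hγ
    (fun u => ofReal_mul_norm_sq_le_J hγ hω u v)
  exact ⟨u, trivial, fun w _ => hu w⟩

theorem StrictlyConvexJ.exists_isJointMinimizer (hJ : StrictlyConvexJ T g q θ ρ ω) (hq : 1 ≤ q)
    (hθ : ∀ i, 0 < θ i) (hρ : ∀ i, 0 < ρ i) {γ : ℝ} (hγ : 0 < γ) (hω : ∀ i, γ ≤ ω i) :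
    ∃ u, IsJointMinimizer T g q θ ρ ω u (optWeight q θ ρ u) := by
  have hω0 : ∀ i, 0 < ω i := fun i => hγ.trans_le (hω i)
  obtain ⟨u, hu⟩ := exists_forall_le_of_coercive (lowerSemicontinuous_J_optWeight hq)
    (fun c hc => hJ.convex_sublevel_optWeight hq hθ hρ hω0 hc) hγ
    (fun u => ofReal_mul_norm_sq_le_J hγ hω u _)
  exact ⟨u, ⟨trivial, optWeight_mem hq hθ hρ u⟩,
    fun p hp => (hu p.1).trans (J_optWeight_le hq hθ hω0 _ hp.2.1)⟩

theorem StrictlyConvexJ.exists_isAlternatingMinimization (hJ : StrictlyConvexJ T g q θ ρ ω)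
    (hq : 1 ≤ q) (hθ : ∀ i, 0 < θ i) (hρ : ∀ i, 0 < ρ i) {γ : ℝ} (hγ : 0 < γ)
    (hω : ∀ i, γ ≤ ω i) {v0 : Λ → ℝ} (hv0 : v0 ∈ weightCone ρ) :
    ∃ u v, IsAlternatingMinimization T g q θ ρ ω v0 u v := by
  have hex : ∀ v : Λ → ℝ, ∃ u, v ∈ weightCone ρ →
      IsArgMin (fun w => J T g q θ ρ ω w v) Set.univ u := fun v => by
    by_cases hv : v ∈ weightCone ρ
    · obtain ⟨u, hu⟩ := hJ.exists_isArgMin_left hq hγ hω hv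
      exact ⟨u, fun _ => hu⟩
    · exact ⟨0, fun h => absurd h hv⟩
  choose U hU using hex
  let v : ℕ → Λ → ℝ := fun n => (fun v => optWeight q θ ρ (U v))^[n] v0
  have hvs : ∀ n, v (n + 1) = optWeight q θ ρ (U (v n)) := fun n =>
    Function.iterate_succ_apply' _ _ _
  have hv : ∀ n, v n ∈ weightCone ρ := by
    rintro (_ | n)
    · exact hv0
    · rw [hvs]; exact optWeight_mem hq hθ hρ _
  -- The truncated index makes entry `n + 1` equal to `U (v n)`; entry `0` is arbitrary.
  refine ⟨fun n => U (v (n - 1)), v, rfl, fun n => hU _ (hv n), fun n => ?_⟩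
  rw [hvs]
  exact isArgMin_optWeight hq hθ hρ (fun i => hγ.trans_le (hω i)) _

/-- Where `v` vanishes, the coupling gives no control. The midpoint with `(0, ρ)` has weight at
least `ρ / 2` and argument `u / 2`, whence the factor 4, and convexity bounds `J` there. -/
theorem StrictlyConvexJ.tsum_rho_mul_qNorm_le (hJ : StrictlyConvexJ T g q θ ρ ω) (hq : 1 ≤ q)
    (hρ : ∀ i, 0 < ρ i) {u : SeqSpace Λ M} {v : Λ → ℝ} (hv : v ∈ weightCone ρ)
    (h : J T g q θ ρ ω u v ≠ ∞) :
    ∑' i, ENNReal.ofReal (ρ i * qNorm q (u i)) ≤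
      ENNReal.ofReal 4 * (J T g q θ ρ ω u v + ENNReal.ofReal (‖g‖ ^ 2)) := by
  have h1 := hJ.le_combo hv (rho_mem_weightCone hρ) h
    (by rw [J_zero_rho hq]; exact ENNReal.ofReal_ne_top) (u' := 0)
    (a := 2⁻¹) (b := 2⁻¹) (by norm_num) (by norm_num) (by norm_num)
  rw [J_zero_rho hq, smul_zero, add_zero] at h1
  have h2 : ∑' i, ENNReal.ofReal (ρ i * qNorm q (u i)) ≤ ENNReal.ofReal 4 *
      J T g q θ ρ ω ((2⁻¹ : ℝ) • u) ((2⁻¹ : ℝ) • v + (2⁻¹ : ℝ) • ρ) := by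
    refine le_trans ?_ (mul_le_mul_right (tsum_mul_qNorm_le_J _ _) _)
    rw [← ENNReal.tsum_mul_left]
    refine ENNReal.tsum_le_tsum fun i => ?_
    rw [← ENNReal.ofReal_mul (by norm_num)]
    refine ENNReal.ofReal_le_ofReal ?_
    change _ ≤ 4 * ((2⁻¹ * v i + 2⁻¹ * ρ i) * qNorm q ((2⁻¹ : ℝ) • u i))
    rw [qNorm_smul hq (by norm_num)]
    nlinarith [mul_nonneg (hv.1 i) (qNorm_nonneg hq (u i))]
  refine h2.trans (mul_le_mul_right (h1.trans ?_) _)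
  have : ENNReal.ofReal 2⁻¹ ≤ 1 := by
    rw [ENNReal.ofReal_le_one]; norm_num
  exact add_le_add (mul_le_of_le_one_left' this) (mul_le_of_le_one_left' this)

/-- The values of `J` along an alternating minimization converge to the minimum. -/
theorem StrictlyConvexJ.tendsto_J_of_alternating (hJ : StrictlyConvexJ T g q θ ρ ω) (hq : 1 ≤ q)
    (hθ : ∀ i, 0 < θ i) (hρ : ∀ i, 0 < ρ i) (hω : ∀ i, 0 < ω i) {U : ℕ → SeqSpace Λ M}
    (h0 : J T g q θ ρ ω (U 0) (optWeight q θ ρ (U 0)) ≠ ∞)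
    (hU : ∀ n w, J T g q θ ρ ω (U (n + 1)) (optWeight q θ ρ (U n)) ≤
      J T g q θ ρ ω w (optWeight q θ ρ (U n)))
    {us : SeqSpace Λ M} (hus : ∀ u, J T g q θ ρ ω us (optWeight q θ ρ us) ≤
      J T g q θ ρ ω u (optWeight q θ ρ u)) :
    Tendsto (fun n => J T g q θ ρ ω (U n) (optWeight q θ ρ (U n))) atTop
      (𝓝 (J T g q θ ρ ω us (optWeight q θ ρ us))) := by
  set G : SeqSpace Λ M → ℝ≥0∞ := fun u => J T g q θ ρ ω u (optWeight q θ ρ u) with hG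
  have hanti : Antitone fun n => G (U n) := antitone_nat_of_succ_le fun n =>
    (J_optWeight_le hq hθ hω _ (optWeight_nonneg _)).trans (hU n (U n))
  have hfin : ∀ n, G (U n) ≠ ∞ := fun n => ne_top_of_le_ne_top h0 (hanti (Nat.zero_le n))
  have hsfin : G us ≠ ∞ := ne_top_of_le_ne_top h0 (hus _)
  set K : ℝ≥0∞ := ENNReal.ofReal 4 * (G (U 0) + ENNReal.ofReal (‖g‖ ^ 2)) with hK
  have hKfin : K ≠ ∞ := by finiteness
  have hSle : ∀ u, G u ≤ G (U 0) → ∑' i, ENNReal.ofReal (ρ i * qNorm q (u i)) ≤ K :=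
    fun u hu => (hJ.tsum_rho_mul_qNorm_le hq hρ (optWeight_mem hq hθ hρ u)
      (ne_top_of_le_ne_top h0 hu)).trans (mul_le_mul_right (add_le_add hu le_rfl) _)
  -- `U (n + 1)` is compared with the point at parameter `t` on the segment from `U n` to `us`; `G
  -- (U n)` is finite and cancels.
  have hstep : ∀ n (t : ℝ), 0 ≤ t → t ≤ 1 → G (U (n + 1)) ≤
      ENNReal.ofReal (1 - t) * G (U n) + ENNReal.ofReal t * G us
        + ENNReal.ofReal (t ^ 2) * (K + K) := by
    intro n t ht0 ht1
    have h1 := J_add_J_le (T := T) (g := g) hq hθ hω (U n) us (optWeight_nonneg (U n))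
      (optWeight_le hq hθ hρ (U n)) (optWeight_nonneg us) (optWeight_le hq hθ hρ us) ht0 ht1
    have h2 := hJ.le_combo (optWeight_mem hq hθ hρ (U n)) (optWeight_mem hq hθ hρ us)
      (hfin n) hsfin (sub_nonneg.2 ht1) ht0 (by ring)
    have h3 : G (U (n + 1)) ≤
        J T g q θ ρ ω ((1 - t) • U n + t • us) (optWeight q θ ρ (U n)) :=
      (J_optWeight_le hq hθ hω _ (optWeight_nonneg _)).trans (hU n _)
    have h4 : G (U n) ≤ J T g q θ ρ ω (U n)
        ((1 - t) • optWeight q θ ρ (U n) + t • optWeight q θ ρ us) :=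
      J_optWeight_le hq hθ hω _ (convex_weightCone (optWeight_mem hq hθ hρ (U n))
        (optWeight_mem hq hθ hρ us) (sub_nonneg.2 ht1) ht0 (by ring)).1
    have h5 : ENNReal.ofReal (t ^ 2) * (∑' i, ENNReal.ofReal (ρ i * qNorm q (U n i)) +
        ∑' i, ENNReal.ofReal (ρ i * qNorm q (us i))) ≤ ENNReal.ofReal (t ^ 2) * (K + K) :=
      mul_le_mul_right (add_le_add (hSle _ (hanti (Nat.zero_le n))) (hSle _ (hus _))) _
    have h6 := ((add_le_add h3 h4).trans h1).trans
      (add_le_add (add_le_add h2 (le_refl (G (U n)))) h5)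
    rw [add_right_comm] at h6
    exact ENNReal.le_of_add_le_add_right (hfin n) h6
  have hstep' : ∀ n (t : ℝ), 0 ≤ t → t ≤ 1 → (G (U (n + 1))).toReal ≤
      (1 - t) * (G (U n)).toReal + t * (G us).toReal + t ^ 2 * (K + K).toReal := by
    intro n t ht0 ht1
    have h := ENNReal.toReal_mono (by have := hfin n; finiteness) (hstep n t ht0 ht1)
    have := hfin n
    rwa [ENNReal.toReal_add (by finiteness) (by finiteness),
      ENNReal.toReal_add (by finiteness) (by finiteness), ENNReal.toReal_mul, ENNReal.toReal_mul,
      ENNReal.toReal_mul, ENNReal.toReal_ofReal (sub_nonneg.2 ht1), ENNReal.toReal_ofReal ht0,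
      ENNReal.toReal_ofReal (sq_nonneg t)] at h
  have hanti' : Antitone fun n => (G (U n)).toReal := fun m n h =>
    ENNReal.toReal_mono (hfin m) (hanti h)
  have hlim := tendsto_atTop_ciInf hanti' ⟨0, by rintro _ ⟨n, rfl⟩; exact ENNReal.toReal_nonneg⟩
  set L := ⨅ n, (G (U n)).toReal
  have hge : (G us).toReal ≤ L := le_ciInf fun n => ENNReal.toReal_mono (hfin n) (hus _)
  have hL : ∀ t : ℝ, 0 ≤ t → t ≤ 1 →
      L ≤ (1 - t) * L + t * (G us).toReal + t ^ 2 * (K + K).toReal := fun t ht0 ht1 =>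
    le_of_tendsto_of_tendsto' ((tendsto_add_atTop_iff_nat 1).2 hlim)
      (((hlim.const_mul _).add_const _).add_const _) fun n => hstep' n t ht0 ht1
  have hle : L ≤ (G us).toReal := by
    refine ge_of_tendsto (f := fun t : ℝ => (G us).toReal + t * (K + K).toReal) (x := 𝓝[>] 0) ?_ ?_
    · have : Tendsto (fun t : ℝ => (G us).toReal + t * (K + K).toReal) (𝓝 0)
          (𝓝 ((G us).toReal + 0 * (K + K).toReal)) :=
        (tendsto_id.mul_const _).const_add _
      rw [zero_mul, add_zero] at this
      exact this.mono_left nhdsWithin_le_nhds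
    · filter_upwards [Ioo_mem_nhdsGT (zero_lt_one' ℝ)] with t ht
      have := hL t ht.1.le ht.2.le
      refine le_of_mul_le_mul_left ?_ ht.1
      linarith
  rw [le_antisymm hle hge] at hlim
  have := (ENNReal.continuous_ofReal.tendsto _).comp hlim
  rw [ENNReal.ofReal_toReal hsfin] at this
  exact this.congr fun n => ENNReal.ofReal_toReal (hfin n)

/-- Minimizing sequences converge strongly when the coupling is uniformly dominated. -/
theorem tendsto_of_tendsto_J (hq : q = 1 ∨ q = 2 ∨ q = ∞) (hq1 : 1 ≤ q) (hθ : ∀ i, 0 < θ i)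
    {γ : ℝ} (hγ : 0 < γ) (hω : ∀ i, γ ≤ ω i) {σ : ℝ} (hσ : phi q M / 4 < σ)
    (hσθ : ∀ i, σ ≤ θ i * ω i) {U : ℕ → SeqSpace Λ M} {us : SeqSpace Λ M}
    (hfin : J T g q θ ρ ω us (optWeight q θ ρ us) ≠ ∞)
    (hus : ∀ u, J T g q θ ρ ω us (optWeight q θ ρ us) ≤ J T g q θ ρ ω u (optWeight q θ ρ u))
    (hU : Tendsto (fun n => J T g q θ ρ ω (U n) (optWeight q θ ρ (U n))) atTop
      (𝓝 (J T g q θ ρ ω us (optWeight q θ ρ us)))) :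
    Tendsto U atTop (𝓝 us) := by
  have hω0 : ∀ i, 0 < ω i := fun i => hγ.trans_le (hω i)
  have hφ := phi_nonneg q M
  have hσ0 : 0 < σ := by linarith
  -- Chosen so that `(1 - ε) σ = φ / 4`.
  obtain ⟨ε, hε⟩ : ∃ ε, ε = 1 - phi q M / 4 / σ := ⟨_, rfl⟩
  have hε0 : 0 < ε := by
    rw [hε, sub_pos]; exact (div_lt_one hσ0).2 hσ
  have hcond : ∀ i, phi q M / 4 ≤ (1 - ε) * (θ i * ω i) := fun i => by
    calc phi q M / 4 = (1 - ε) * σ := by rw [hε]; field_simp; ring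
      _ ≤ _ := mul_le_mul_of_nonneg_left (hσθ i) (by rw [hε, sub_sub_cancel]; positivity)
  set G : SeqSpace Λ M → ℝ≥0∞ := fun u => J T g q θ ρ ω u (optWeight q θ ρ u)
  -- The value of `J` at the midpoint, with averaged weights, is at least `G us`.
  have hkey : ∀ u, G us + ENNReal.ofReal (ε * γ / 4 * ‖u - us‖ ^ 2) ≤
      ENNReal.ofReal 2⁻¹ * G u + ENNReal.ofReal 2⁻¹ * G us := by
    intro u
    refine le_trans (add_le_add ?_ le_rfl) (J_midpoint_add_le hq1 hθ hγ hω (qNorm_sq_le hq)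
      hε0.le hcond u us (optWeight_nonneg u) (optWeight_nonneg us))
    exact (hus _).trans (J_optWeight_le hq1 hθ hω0 _ fun i =>
      add_nonneg (mul_nonneg (by norm_num) (optWeight_nonneg u i))
        (mul_nonneg (by norm_num) (optWeight_nonneg us i)))
  have hlim : Tendsto (fun n => (G (U n)).toReal) atTop (𝓝 (G us).toReal) :=
    (ENNReal.tendsto_toReal hfin).comp hU
  have hsq : Tendsto (fun n => ‖U n - us‖ ^ 2) atTop (𝓝 0) := by
    have hup : Tendsto (fun n => ((G (U n)).toReal - (G us).toReal) * (2 / (ε * γ))) atTop (𝓝 0) := by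
      simpa using (hlim.sub_const (G us).toReal).mul_const (2 / (ε * γ))
    refine tendsto_of_tendsto_of_tendsto_of_le_of_le' tendsto_const_nhds hup
      (Eventually.of_forall fun n => sq_nonneg _) ?_
    filter_upwards [hU.eventually_lt_const (lt_top_iff_ne_top.2 hfin)] with n hn
    have hn' : G (U n) ≠ ∞ := hn.ne
    have h := ENNReal.toReal_mono (by finiteness) (hkey (U n))
    rw [ENNReal.toReal_add (by finiteness) (by finiteness),
      ENNReal.toReal_add (by finiteness) (by finiteness), ENNReal.toReal_mul, ENNReal.toReal_mul,
      ENNReal.toReal_ofReal (by positivity), ENNReal.toReal_ofReal (by norm_num)] at h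
    rw [← mul_div_assoc, le_div_iff₀ (by positivity)]
    linarith
  rw [tendsto_iff_norm_sub_tendsto_zero]
  have := hsq.sqrt
  simpa using this

theorem tendsto_weightedL2Norm_optWeight (hq : q = 1 ∨ q = 2 ∨ q = ∞) (hq1 : 1 ≤ q)
    (hθ : ∀ i, 0 < θ i) {U : ℕ → SeqSpace Λ M} {us : SeqSpace Λ M}
    (hU : Tendsto U atTop (𝓝 us)) :
    Tendsto (fun n => weightedL2Norm θ (optWeight q θ ρ (U n) - optWeight q θ ρ us)) atTop
      (𝓝 0) := by
  have hφ := phi_nonneg q M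
  have hle : ∀ n, ∑' i, ENNReal.ofReal
      ((θ i * |(optWeight q θ ρ (U n) - optWeight q θ ρ us) i|) ^ 2) ≤
        ENNReal.ofReal (phi q M / 4 * ‖U n - us‖ ^ 2) := by
    intro n
    rw [ofReal_mul_norm_sq_eq_tsum (by positivity)]
    refine ENNReal.tsum_le_tsum fun i => ENNReal.ofReal_le_ofReal ?_
    have h1 := mul_abs_optWeight_sub_le (ρ := ρ) hq1 hθ (U n) us i
    have h2 := qNorm_sq_le hq (U n i - us i)
    have h3 := pow_le_pow_left₀ (mul_nonneg (hθ i).le (abs_nonneg _)) h1 2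
    change (θ i * |optWeight q θ ρ (U n) i - optWeight q θ ρ us i|) ^ 2 ≤
      phi q M / 4 * ‖U n i - us i‖ ^ 2
    linarith
  have hr : Tendsto (fun n => phi q M / 4 * ‖U n - us‖ ^ 2) atTop (𝓝 0) := by
    simpa using ((tendsto_iff_norm_sub_tendsto_zero.1 hU).pow 2).const_mul (phi q M / 4)
  have h0 := (ENNReal.continuous_ofReal.tendsto 0).comp hr
  rw [ENNReal.ofReal_zero] at h0
  have hs := tendsto_of_tendsto_of_tendsto_of_le_of_le tendsto_const_nhds h0
    (fun n => zero_le) hle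
  have := ((ENNReal.continuous_rpow_const (y := (1 / 2 : ℝ))).tendsto 0).comp hs
  rw [ENNReal.zero_rpow_of_pos (by norm_num)] at this
  exact this

end StrictlyConvex
end JointSparsity

/-! ### The main theorem -/

open JointSparsity

theorem mainTheorem1 {Λ : Type*} [Countable Λ] (M : ℕ)
    {H : Type*} [NormedAddCommGroup H] [InnerProductSpace ℝ H] [CompleteSpace H]
    (T : JointSparsity.SeqSpace Λ M →L[ℝ] H) (g : H)
    (q : ℝ≥0∞) (hq : 1 ≤ q) (θ ρ ω : Λ → ℝ)
    (hθ : ∀ i, 0 < θ i) (hρ : ∀ i, 0 < ρ i)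
    (γ : ℝ) (hγ : 0 < γ) (hω : ∀ i, γ ≤ ω i)
    (hJ : JointSparsity.StrictlyConvexJ T g q θ ρ ω) :
    ∃ (us : JointSparsity.SeqSpace Λ M) (vs : Λ → ℝ),
      -- `(us, vs)` is the unique minimizer of `J`
      JointSparsity.IsJointMinimizer T g q θ ρ ω us vs ∧
      (∀ u v, JointSparsity.IsJointMinimizer T g q θ ρ ω u v → u = us ∧ v = vs) ∧
      -- for every initial choice `v0` for which `J(·, v0)` is not identically infinite
      ∀ v0 ∈ JointSparsity.weightCone ρ,
        (∃ u : JointSparsity.SeqSpace Λ M, JointSparsity.J T g q θ ρ ω u v0 ≠ ∞) →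
        -- the iteration can be carried out
        (∃ u v, JointSparsity.IsAlternatingMinimization T g q θ ρ ω v0 u v) ∧
        ∀ u v, JointSparsity.IsAlternatingMinimization T g q θ ρ ω v0 u v →
          -- each step has only one minimizer
          (∀ n u', JointSparsity.IsArgMin (fun w => JointSparsity.J T g q θ ρ ω w (v n))
              Set.univ u' → u' = u (n + 1)) ∧
          (∀ n v', JointSparsity.IsArgMin (fun w => JointSparsity.J T g q θ ρ ω (u (n + 1)) w)
              (JointSparsity.weightCone ρ) v' → v' = v (n + 1)) ∧
          -- weak and componentwise convergence
          JointSparsity.WeaklyConverges u us ∧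
          (∀ i, Tendsto (fun n => v n i) atTop (𝓝 (vs i))) ∧
          -- strong convergence for `q ∈ {1, 2, ∞}`
          ((q = 1 ∨ q = 2 ∨ q = ∞) →
            (∃ σ : ℝ, JointSparsity.phi q M / 4 < σ ∧ ∀ i, σ ≤ θ i * ω i) →
            Tendsto u atTop (𝓝 us) ∧
            Tendsto (fun n => JointSparsity.weightedL2Norm θ (v n - vs)) atTop (𝓝 0)) := by
  have hω0 : ∀ i, 0 < ω i := fun i => hγ.trans_le (hω i)
  obtain ⟨us, hmin⟩ := hJ.exists_isJointMinimizer hq hθ hρ hγ hω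
  have hus : ∀ u, J T g q θ ρ ω us (optWeight q θ ρ us) ≤ J T g q θ ρ ω u (optWeight q θ ρ u) :=
    fun u => isMinOn_iff.1 hmin.2 (u, optWeight q θ ρ u) ⟨trivial, optWeight_mem hq hθ hρ u⟩
  refine ⟨us, optWeight q θ ρ us, hmin, fun u v h => hJ.eq_of_isJointMinimizer hq hρ h hmin,
    fun v0 hv0 hfin0 => ⟨hJ.exists_isAlternatingMinimization hq hθ hρ hγ hω hv0,
      fun u v halt => ?_⟩⟩
  have hv : ∀ n, v n ∈ weightCone ρ := by
    rintro (_ | n)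
    · rw [halt.init]; exact hv0
    · exact (halt.v_step n).1
  have hfin : ∀ n, J T g q θ ρ ω (u (n + 1)) (v n) ≠ ∞ := by
    intro n
    induction n with
    | zero =>
      obtain ⟨w, hw⟩ := hfin0
      have := isMinOn_iff.1 (halt.u_step 0).2 w trivial
      rw [halt.init] at this ⊢
      exact ne_top_of_le_ne_top hw this
    | succ n ih =>
      exact ne_top_of_le_ne_top ih ((isMinOn_iff.1 (halt.u_step (n + 1)).2 (u (n + 1)) trivial).trans
        (isMinOn_iff.1 (halt.v_step n).2 (v n) (hv n)))
  have hfin' : ∀ n, J T g q θ ρ ω (u (n + 1)) (v (n + 1)) ≠ ∞ := fun n =>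
    ne_top_of_le_ne_top (hfin n) (isMinOn_iff.1 (halt.v_step n).2 (v n) (hv n))
  have hopt : ∀ n, v (n + 1) = optWeight q θ ρ (u (n + 1)) := fun n =>
    hJ.eq_of_isArgMin_right (hfin' n) (halt.v_step n) (isArgMin_optWeight hq hθ hρ hω0 _)
  have hJfin : J T g q θ ρ ω (u 1) (optWeight q θ ρ (u 1)) ≠ ∞ := hopt 0 ▸ hfin' 0
  -- The sequence is shifted by one: `u 0` is unconstrained and `v 0` need not be an optimal weight.
  have hval := hJ.tendsto_J_of_alternating hq hθ hρ hω0 (U := fun n => u (n + 1)) hJfin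
    (fun n w => hopt n ▸ isMinOn_iff.1 (halt.u_step (n + 1)).2 w trivial) hus
  have hsfin : J T g q θ ρ ω us (optWeight q θ ρ us) ≠ ∞ := ne_top_of_le_ne_top hJfin (hus _)
  have hweak : WeaklyConverges u us := fun f => (tendsto_add_atTop_iff_nat 1).1 <|
    tendsto_apply_of_tendsto_min (lowerSemicontinuous_J_optWeight hq)
      (fun c hc => hJ.convex_sublevel_optWeight hq hθ hρ hω0 hc) hγ
      (fun u => ofReal_mul_norm_sq_le_J hγ hω u _) hsfin
      (fun x hx => (hJ.eq_of_isJointMinimizer hq hρ ⟨⟨trivial, optWeight_mem hq hθ hρ x⟩,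
        fun p hp => hx.trans (hmin.2 hp)⟩ hmin).1) hval f
  refine ⟨fun n u' h => hJ.eq_of_isArgMin_left (hv n)
      (ne_top_of_le_ne_top (hfin n) (isMinOn_iff.1 h.2 _ trivial)) h (halt.u_step n),
    fun n v' h => (hJ.eq_of_isArgMin_right (hfin' n) (halt.v_step n) h).symm, hweak, fun i => ?_,
    fun hq' ⟨σ, hσ, hσθ⟩ => ?_⟩
  -- Scalar coordinates are bounded functionals and `ℝ^M` is finite-dimensional; the weight at `i`
  -- depends continuously on `u i` alone.
  · have hcoord : Tendsto (fun n => u n i) atTop (𝓝 (us i)) := by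
      refine ((PiLp.continuous_toLp 2 _).tendsto _).comp (tendsto_pi_nhds.2 fun k => ?_)
      exact hweak ((EuclideanSpace.proj k).comp
        (lp.evalCLM ℝ (fun _ : Λ => EuclideanSpace ℝ (Fin M)) 2 i))
    refine (tendsto_add_atTop_iff_nat 1).1 ?_
    simp only [hopt]
    exact ((continuous_optWeight_of hq i).tendsto _).comp ((tendsto_add_atTop_iff_nat 1).2 hcoord)
  · have hstrong := tendsto_of_tendsto_J hq' hq hθ hγ hω hσ hσθ hsfin hus hval
    refine ⟨(tendsto_add_atTop_iff_nat 1).1 hstrong, (tendsto_add_atTop_iff_nat 1).1 ?_⟩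
    simp only [hopt]
    exact tendsto_weightedL2Norm_optWeight hq' hq hθ hstrong
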